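/- For an integer $n\ge 0$ and $x\in\mathbb R$ let $I_n(x)=\sum_{k=0}^\infty \frac{(x/2)^{2k+n}}{k!\,(k+n)!}$ be the modified Bessel function of the first kind of order $n$. Fix $V>0$, and for $B>0$ and $r\in[0,1]$ define \[ \lambda_{1,1}^*(B)=\frac{4V}{\pi}\left[1-\frac{4I_2(\sqrt B)}{\sqrt B\,I_1(\sqrt B)}\right]^{-1}, \] \[ h_1^*(B;r)=\frac{\lambda_{1,1}^*(B)}{2}(1-r^2)-\frac{\lambda_{1,1}^*(B)}{\sqrt B\,I_1(\sqrt B)}\left[I_0(\sqrt B)-I_0(\sqrt B\,r)\right]. \] Then: 1. the map $B\mapsto\lambda_{1,1}^*(B)$ is strictly decreasing on $(0,\infty)$; 2. $\lambda_{1,1}^*(B)\to \dfrac{4V}{\pi}$ as $B\to\infty$; 3. for every $r\in[0,1]$, $h_1^*(B;r)\to \dfrac{2V(1-r^2)}{\pi}$ as $B\to\infty$. -/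

import Mathlib

namespace Sloshing

/-- The modified Bessel function of the first kind `I_n` of integer order `n ≥ 0`, on the real line:
`I_n(x) = ∑ k, (x / 2) ^ (2 k + n) / (k! (k + n)!)`. -/
noncomputable def besselI (n : ℕ) (x : ℝ) : ℝ :=
  ∑' k : ℕ, (x / 2) ^ (2 * k + n) / ((k.factorial : ℝ) * ((k + n).factorial : ℝ))

/-- The series defining `I_n(x)` converges, for every `n` and every real `x`. -/
theorem summable_besselI (n : ℕ) (x : ℝ) :
    Summable fun k : ℕ =>
      (x / 2) ^ (2 * k + n) / ((k.factorial : ℝ) * ((k + n).factorial : ℝ)) := by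
  have h := (Real.summable_pow_div_factorial ((x / 2) ^ 2)).mul_left (|x / 2| ^ n)
  refine Summable.of_norm_bounded h fun k => ?_
  have h1 : (1 : ℝ) ≤ ((k + n).factorial : ℝ) := by
    exact_mod_cast Nat.succ_le_of_lt (Nat.factorial_pos _)
  have h2 : (0 : ℝ) < (k.factorial : ℝ) := by exact_mod_cast Nat.factorial_pos k
  rw [norm_div, norm_pow, Real.norm_eq_abs, Real.norm_eq_abs,
    abs_of_pos (mul_pos h2 (lt_of_lt_of_le one_pos h1)), pow_add, pow_mul, sq_abs, mul_comm,
    mul_div_assoc]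
  gcongr
  exact le_mul_of_one_le_right h2.le h1

/-- The squared maximal sloshing frequency `λ*_{1,1}` for volume `V`, as a function of the
Bond number `B`. -/
noncomputable def lambdaStar (V B : ℝ) : ℝ :=
  4 * V / Real.pi * (1 - 4 * besselI 2 (√B) / (√B * besselI 1 (√B)))⁻¹

/-- The maximizing depth profile `h*_1` for volume `V` and Bond number `B`, as a function of the
radius `r`. -/
noncomputable def hStar (V B r : ℝ) : ℝ :=
  lambdaStar V B / 2 * (1 - r ^ 2)
    - lambdaStar V B / (√B * besselI 1 (√B)) * (besselI 0 (√B) - besselI 0 (√B * r))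

end Sloshing

namespace Sloshing

open Filter Topology

/-! With `x = √B`, everything rests on `R(x) = 4 I_2(x) / (x I_1(x))`, which is twice the mean of `1
/ (k + 2)` weighted by the terms of the series of `I_1(x)`. Increasing `x` shifts weight to larger
`k`, so `R` strictly decreases (`weighted_mean_lt`); `R < 1` since `1 / (k + 2) ≤ 1 / 2`; and `R ≤ 4
/ x` since `I_2 ≤ I_1`, so `R → 0`. The profile also needs `(I_0(x) - I_0(x r)) / (x I_1(x)) → 0`,
which follows from `I_0 ≤ (1 + 2 / x) I_1`. -/

theorem hasSum_besselI (n : ℕ) (x : ℝ) :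
    HasSum (fun k : ℕ =>
      (x / 2) ^ (2 * k + n) / ((k.factorial : ℝ) * ((k + n).factorial : ℝ))) (besselI n x) :=
  (summable_besselI n x).hasSum

theorem besselI_nonneg (n : ℕ) {x : ℝ} (hx : 0 ≤ x) : 0 ≤ besselI n x :=
  tsum_nonneg fun k => by positivity

theorem besselI_pos (n : ℕ) {x : ℝ} (hx : 0 < x) : 0 < besselI n x :=
  (summable_besselI n x).tsum_pos (fun k => by positivity) 0 (by positivity)

theorem besselI_le_besselI (n : ℕ) {x y : ℝ} (hx : 0 ≤ x) (hxy : x ≤ y) :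
    besselI n x ≤ besselI n y :=
  (summable_besselI n x).tsum_le_tsum (fun k => by gcongr) (summable_besselI n y)

/-- On `[0, ∞)` the modified Bessel functions decrease with the order: each term of `I_{n+1}` is at
most the mean of two consecutive terms of `I_n`. -/
theorem besselI_succ_le (n : ℕ) {x : ℝ} (hx : 0 ≤ x) : besselI (n + 1) x ≤ besselI n x := by
  set u : ℕ → ℝ := fun k =>
    (x / 2) ^ (2 * k + n) / ((k.factorial : ℝ) * ((k + n).factorial : ℝ)) with hu
  have hs : HasSum u (besselI n x) := hasSum_besselI n x
  have hs1 : HasSum (fun k => u (k + 1)) (besselI n x - u 0) := by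
    simpa using (hasSum_nat_add_iff' 1).2 hs
  have hu0 : ∀ k, 0 ≤ u k := fun k => by positivity
  have key : besselI (n + 1) x ≤ (besselI n x + (besselI n x - u 0)) / 2 := by
    refine hasSum_le (fun k => ?_) (hasSum_besselI (n + 1) x) ((hs.add hs1).div_const 2)
    have hfac : ((k + (n + 1)).factorial : ℝ) = (k + n + 1) * (k + n).factorial := by
      rw [← add_assoc, Nat.factorial_succ]; push_cast; ring
    have e1 : u (k + 1) = u k * (x / 2) ^ 2 / ((k + 1) * (k + n + 1)) := by
      simp only [hu]
      rw [show k + 1 + n = k + (n + 1) by ring, hfac, Nat.factorial_succ]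
      push_cast
      field_simp
      ring
    have e2 : (x / 2) ^ (2 * k + (n + 1)) /
        ((k.factorial : ℝ) * ((k + (n + 1)).factorial : ℝ)) = u k * ((x / 2) / (k + n + 1)) := by
      simp only [hu]
      rw [hfac]
      field_simp
      ring
    -- With `a = x / 2 / (k + n + 1)`, the bound is `a ≤ (1 + a ^ 2) / 2`, where `a ^ 2` is at most
    -- the factor taking `u k` to `u (k + 1)`.
    have h3 : (x / 2 / (k + n + 1)) ^ 2 ≤ (x / 2) ^ 2 / ((k + 1) * (k + n + 1)) := by
      rw [div_pow, sq ((k : ℝ) + n + 1)]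
      gcongr
      linarith [(Nat.cast_nonneg n : (0 : ℝ) ≤ n)]
    rw [e1, e2]
    have h4 : x / 2 / (k + n + 1) ≤ (1 + (x / 2) ^ 2 / ((k + 1) * (k + n + 1))) / 2 := by
      nlinarith [sq_nonneg (x / 2 / (k + n + 1) - 1)]
    calc u k * (x / 2 / (k + n + 1))
        ≤ u k * ((1 + (x / 2) ^ 2 / ((k + 1) * (k + n + 1))) / 2) :=
          mul_le_mul_of_nonneg_left h4 (hu0 k)
      _ = _ := by ring
  linarith [hu0 0]

/-- The recurrence `I_0 = I_2 + (2 / x) I_1`. -/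
theorem besselI_zero_eq {x : ℝ} (hx : x ≠ 0) :
    besselI 0 x = besselI 2 x + 2 / x * besselI 1 x := by
  have h := (hasSum_besselI 0 x).sub ((hasSum_besselI 1 x).mul_left (2 / x))
  -- The term `k = 0` of the difference is `1 - 1 = 0`; dropping it aligns the rest with `I_2`.
  have h1 := (hasSum_nat_add_iff' 1).2 h
  have h2 := h1.unique (a₂ := besselI 2 x) <| (hasSum_besselI 2 x).congr_fun fun k => by
    rw [show k + 1 + 1 = k + 2 by ring, add_zero, Nat.factorial_succ (k + 1),
      Nat.factorial_succ k]
    push_cast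
    field_simp
    ring
  simp [hx] at h2
  linarith

/-- Rescaling the weights `w k` by `q ^ (2 k + 1)` with `1 < q` strictly lowers the weighted mean
of `1 / (k + 2)`. -/
theorem weighted_mean_lt {w : ℕ → ℝ} {q W W' M M' : ℝ} (hw : ∀ k, 0 < w k) (hq : 1 < q)
    (hW : HasSum w W) (hM : HasSum (fun k => w k / (k + 2)) M)
    (hW' : HasSum (fun k => w k * q ^ (2 * k + 1)) W')
    (hM' : HasSum (fun k => w k * q ^ (2 * k + 1) / (k + 2)) M') :
    M' / W' < M / W := by
  have hWpos : 0 < W := hW.tsum_eq ▸ hW.summable.tsum_pos (fun k => (hw k).le) 0 (hw 0)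
  have hMpos : 0 < M := hM.tsum_eq ▸ hM.summable.tsum_pos
    (fun k => (div_pos (hw k) (by positivity)).le) 0 (div_pos (hw 0) (by positivity))
  have hW'pos : 0 < W' := hW'.tsum_eq ▸ hW'.summable.tsum_pos
    (fun k => (mul_pos (hw k) (by positivity)).le) 0 (mul_pos (hw 0) (by positivity))
  set ρ := M / W with hρ
  have hρpos : 0 < ρ := div_pos hMpos hWpos
  -- `1 / (k + 2) - ρ` changes sign around `N`. Its sign at `k = N` is never needed, since the
  -- powers of `q` compared below agree there.
  set N := ⌊1 / ρ - 2⌋₊ with hN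
  have hneg : ∀ k, N < k → 1 / ((k : ℝ) + 2) - ρ < 0 := fun k hk => by
    have h : 1 / ρ - 2 < k := (Nat.floor_lt' (by omega)).1 hk
    rw [sub_neg, div_lt_iff₀ (by positivity)]
    have : 1 / ρ < k + 2 := by linarith
    rw [div_lt_iff₀ hρpos] at this
    linarith
  have hnonneg : ∀ k, k < N → 0 ≤ 1 / ((k : ℝ) + 2) - ρ := fun k hk => by
    have h : (k : ℝ) ≤ 1 / ρ - 2 :=
      ((Nat.le_floor_iff' (by omega)).1 (Nat.succ_le_of_lt hk)).trans' (by push_cast; linarith)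
    rw [sub_nonneg, le_div_iff₀ (by positivity)]
    have : (k : ℝ) + 2 ≤ 1 / ρ := by linarith
    rw [le_div_iff₀ hρpos] at this
    linarith
  have hs := ((hM.sub (hW.mul_left ρ)).mul_left (q ^ (2 * N + 1)))
  have hs' := hM'.sub (hW'.mul_left ρ)
  -- Replacing `q ^ (2 k + 1)` by `q ^ (2 N + 1)` lowers no term, whichever the sign, and strictly
  -- raises term `N + 1`. The right side vanishes by the choice of `ρ`.
  have hlt : M' - ρ * W' < q ^ (2 * N + 1) * (M - ρ * W) := by
    refine hasSum_lt (i := N + 1) (fun k => ?_) ?_ hs' hs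
    · have e1 : w k * q ^ (2 * k + 1) / (k + 2) - ρ * (w k * q ^ (2 * k + 1))
        = w k * ((1 / ((k : ℝ) + 2) - ρ) * q ^ (2 * k + 1)) := by ring
      have e2 : q ^ (2 * N + 1) * (w k / (k + 2) - ρ * w k)
        = w k * ((1 / ((k : ℝ) + 2) - ρ) * q ^ (2 * N + 1)) := by ring
      simp only [e1, e2]
      refine mul_le_mul_of_nonneg_left ?_ (hw k).le
      rcases lt_trichotomy k N with h | h | h
      · exact mul_le_mul_of_nonneg_left (pow_le_pow_right₀ hq.le (by omega)) (hnonneg k h)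
      · rw [h]
      · exact mul_le_mul_of_nonpos_left (pow_le_pow_right₀ hq.le (by omega)) (hneg k h).le
    · have h := hneg (N + 1) (by omega)
      have hp : q ^ (2 * N + 1) < q ^ (2 * (N + 1) + 1) := pow_lt_pow_right₀ hq (by omega)
      have := mul_lt_mul_of_pos_left (mul_lt_mul_of_neg_left hp h) (hw (N + 1))
      calc _ = w (N + 1) * ((1 / (((N + 1 : ℕ) : ℝ) + 2) - ρ) * q ^ (2 * (N + 1) + 1)) := by ring
        _ < _ := this
        _ = _ := by ring
  have hzero : M - ρ * W = 0 := by rw [hρ, div_mul_cancel₀ _ hWpos.ne', sub_self]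
  rw [hzero, mul_zero] at hlt
  rw [div_lt_iff₀ hW'pos]
  linarith

/-- `2 I_2(x) / x` is the series of `I_1(x)` with the `k`-th term divided by `k + 2`. -/
theorem hasSum_two_mul_besselI_two_div {x : ℝ} (hx : x ≠ 0) :
    HasSum (fun k : ℕ => (x / 2) ^ (2 * k + 1) /
      ((k.factorial : ℝ) * ((k + 1).factorial : ℝ)) / (k + 2)) (2 / x * besselI 2 x) := by
  refine ((hasSum_besselI 2 x).mul_left (2 / x)).congr_fun fun k => ?_
  rw [show k + 2 = k + 1 + 1 by ring, Nat.factorial_succ (k + 1)]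
  push_cast
  field_simp
  ring

theorem besselI_ratio_eq (x : ℝ) :
    4 * besselI 2 x / (x * besselI 1 x) = 2 * (2 / x * besselI 2 x / besselI 1 x) := by
  ring

/-- Passing from `s` to `t` multiplies the `k`-th term of `I_1` by `(t / s) ^ (2 k + 1)`, the
rescaling of `weighted_mean_lt`. -/
theorem strictAntiOn_besselI_ratio :
    StrictAntiOn (fun x : ℝ => 4 * besselI 2 x / (x * besselI 1 x)) (Set.Ioi 0) := by
  intro s hs t ht hst
  have hs0 : 0 < s := hs
  have ht0 : 0 < t := ht
  simp only [besselI_ratio_eq]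
  refine mul_lt_mul_of_pos_left ?_ two_pos
  have e : ∀ k : ℕ, (s / 2) ^ (2 * k + 1) / ((k.factorial : ℝ) * ((k + 1).factorial : ℝ)) *
      (t / s) ^ (2 * k + 1) =
      (t / 2) ^ (2 * k + 1) / ((k.factorial : ℝ) * ((k + 1).factorial : ℝ)) := fun k => by
    rw [div_mul_eq_mul_div, ← mul_pow]
    congr 2
    field_simp
  refine weighted_mean_lt (q := t / s)
    (w := fun k => (s / 2) ^ (2 * k + 1) / ((k.factorial : ℝ) * ((k + 1).factorial : ℝ)))
    (fun k => by positivity) ((one_lt_div hs0).2 hst) (hasSum_besselI 1 s)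
    (hasSum_two_mul_besselI_two_div hs0.ne') ?_ ?_
  · simpa only [e] using hasSum_besselI 1 t
  · simpa only [e] using hasSum_two_mul_besselI_two_div ht0.ne'

theorem besselI_ratio_lt_one {x : ℝ} (hx : 0 < x) :
    4 * besselI 2 x / (x * besselI 1 x) < 1 := by
  have h : 2 / x * besselI 2 x < besselI 1 x / 2 := by
    -- The terms at `k = 0` are equal, so strictness comes from `k = 1`.
    refine hasSum_lt (i := 1) (fun k => ?_) ?_ (hasSum_two_mul_besselI_two_div hx.ne')
      ((hasSum_besselI 1 x).div_const 2)
    · exact div_le_div_of_nonneg_left (by positivity) two_pos (by simp)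
    · exact div_lt_div_of_pos_left (by positivity) two_pos (by norm_num)
  rw [besselI_ratio_eq]
  have := (div_lt_iff₀ (besselI_pos 1 hx)).2
    (show 2 / x * besselI 2 x < 1 / 2 * besselI 1 x by linarith)
  linarith

theorem tendsto_besselI_ratio :
    Tendsto (fun x : ℝ => 4 * besselI 2 x / (x * besselI 1 x)) atTop (𝓝 0) := by
  refine squeeze_zero' (g := fun x : ℝ => 4 / x) ?_ ?_ (tendsto_const_nhds.div_atTop tendsto_id)
  · filter_upwards [eventually_gt_atTop 0] with x hx
    have := besselI_pos 1 hx
    have := besselI_pos 2 hx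
    positivity
  · filter_upwards [eventually_gt_atTop 0] with x hx
    rw [div_le_div_iff₀ (mul_pos hx (besselI_pos 1 hx)) hx]
    have := mul_le_mul_of_nonneg_left (besselI_succ_le 1 hx.le) hx.le
    norm_num at this
    linarith

theorem tendsto_besselI_zero_sub_div {r : ℝ} (hr : r ∈ Set.Icc (0 : ℝ) 1) :
    Tendsto (fun x : ℝ => (besselI 0 x - besselI 0 (x * r)) / (x * besselI 1 x))
      atTop (𝓝 0) := by
  refine squeeze_zero' (g := fun x : ℝ => (1 + 2 / x) * x⁻¹) ?_ ?_ ?_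
  · filter_upwards [eventually_gt_atTop 0] with x hx
    have h1 := besselI_pos 1 hx
    have h2 := besselI_le_besselI 0 (mul_nonneg hx.le hr.1) (mul_le_of_le_one_right hx.le hr.2)
    exact div_nonneg (sub_nonneg.2 h2) (by positivity)
  · filter_upwards [eventually_gt_atTop 0] with x hx
    have h1 := besselI_pos 1 hx
    have h2 := besselI_nonneg 0 (mul_nonneg hx.le hr.1)
    have h3 := besselI_succ_le 1 hx.le
    norm_num at h3
    have h4 := besselI_zero_eq hx.ne'
    rw [div_le_iff₀ (mul_pos hx h1)]
    -- Drop `I_0(x r) ≥ 0` and use `I_2 ≤ I_1` in the recurrence for `I_0`.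
    calc _ ≤ (1 + 2 / x) * besselI 1 x := by linarith
      _ = _ := by field_simp
  · have h : Tendsto (fun x : ℝ => 2 / x) atTop (𝓝 0) :=
      tendsto_const_nhds.div_atTop tendsto_id
    simpa using (h.const_add 1).mul tendsto_inv_atTop_zero

theorem strictAntiOn_lambdaStar {V : ℝ} (hV : 0 < V) :
    StrictAntiOn (fun B : ℝ => lambdaStar V B) (Set.Ioi 0) := by
  intro a ha b hb hab
  have ha' : 0 < √a := Real.sqrt_pos.2 ha
  have hb' : 0 < √b := Real.sqrt_pos.2 hb
  have h := strictAntiOn_besselI_ratio ha' hb' (Real.sqrt_lt_sqrt (le_of_lt ha) hab)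
  have h1 := besselI_ratio_lt_one ha'
  simp only at h
  have := Real.pi_pos
  refine mul_lt_mul_of_pos_left (inv_strictAnti₀ ?_ ?_) (by positivity)
  · linarith
  · linarith

theorem tendsto_lambdaStar (V : ℝ) :
    Tendsto (fun B : ℝ => lambdaStar V B) atTop (𝓝 (4 * V / Real.pi)) := by
  have h := (tendsto_besselI_ratio.comp Real.tendsto_sqrt_atTop).const_sub 1
  simpa [lambdaStar] using (h.inv₀ (by norm_num)).const_mul (4 * V / Real.pi)

theorem tendsto_hStar (V : ℝ) {r : ℝ} (hr : r ∈ Set.Icc (0 : ℝ) 1) :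
    Tendsto (fun B : ℝ => hStar V B r) atTop (𝓝 (2 * V * (1 - r ^ 2) / Real.pi)) := by
  have hl := tendsto_lambdaStar V
  have h := ((hl.div_const 2).mul_const (1 - r ^ 2)).sub
    (hl.mul ((tendsto_besselI_zero_sub_div hr).comp Real.tendsto_sqrt_atTop))
  convert h using 2
  · simp only [hStar, Function.comp]
    ring
  · ring

end Sloshing

theorem mainTheorem8 (V : ℝ) (hV : 0 < V) :
    StrictAntiOn (fun B : ℝ => Sloshing.lambdaStar V B) (Set.Ioi 0) ∧
    Filter.Tendsto (fun B : ℝ => Sloshing.lambdaStar V B) Filter.atTop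
      (nhds (4 * V / Real.pi)) ∧
    ∀ r ∈ Set.Icc (0 : ℝ) 1,
      Filter.Tendsto (fun B : ℝ => Sloshing.hStar V B r) Filter.atTop
        (nhds (2 * V * (1 - r ^ 2) / Real.pi)) :=
  ⟨Sloshing.strictAntiOn_lambdaStar hV, Sloshing.tendsto_lambdaStar V,
    fun _ hr => Sloshing.tendsto_hStar V hr⟩
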